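/- Let $\ell \ge 2$ (even or odd) and let $G$ be a connected semisimple complex group of type $A_{\ell-1}$, that is, $G = \pi(\mathrm{SL}_\ell(\mathbb C))$ for a surjective homomorphism $\pi$ with kernel contained in the centre of $\mathrm{SL}_\ell(\mathbb C)$. Let $A \le G$ be the image of the diagonal torus and $\tilde W = N_G(A)/A$ the Weyl group, with simple roots $\gamma_k = e_k - e_{k+1}$ and simple reflections $w_k$ ($1 \le k < \ell$). An element of $\tilde W$ is elliptic if its conjugacy class meets no subgroup $\langle w_k : k \in \theta\rangle$ with $\theta \subsetneq \{1,\dots,\ell-1\}$. Identify $V = X_*(A)\otimes\mathbb R$ with $\{x \in \mathbb R^\ell : \sum x_i = 0\}$, let $\check\omega_k = e_1+\dots+e_k-\frac{k}{\ell}(e_1+\dots+e_\ell)$ be the fundamental coweights, and let $C = \{x \in V : 0 < x_i - x_j < 1 \text{ for } i<j\}$ be the fundamental alcove. Write the highest root as $\sum_k c_k\gamma_k$, define $b_k$ by $\check\omega_k(\gamma_j) = \frac{b_k}{c_k}\delta_{kj}$ for $1\le k,j<\ell$, and put $b_0 = 1$ for the affine node $\gamma_0 = 1 - \sum_k c_k\gamma_k$.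 The vertices of $C$ are $v_0 = 0$ and $v_k = \check\omega_k/b_k$. For $g \in G$ of finite order $m$ and a primitive $m$-th root of unity $\xi$, a Kac diagram of $g$ is a labelling $(s_0,\dots,s_{\ell-1})$ of the nodes $\gamma_0,\dots,\gamma_{\ell-1}$ of the affine Dynkin diagram by non-negative integers obtained as follows: choose a cocharacter $\lambda \in X_*(A)$ such that $g$ is $G$-conjugate to $\lambda(\xi)$ and $\lambda/m$ lies in the closure of $C$; write $\lambda/m = \frac1m\sum_{k=0}^{\ell-1} s'_k b_k v_k$ with $s'_k \in \mathbb Z_{\ge 0}$ and $m = \sum_{k=0}^{\ell-1} s'_k b_k$; and divide the $s'_k$ by their greatest common divisor. Then: (1) the elliptic elements of $\tilde W$ form exactly one conjugacy class, namely that of the Coxeter element $w_1w_2\cdots w_{\ell-1}$. (2) $b_k = 1$ for all $0 \le k < \ell$. (3) Every lift $n \in N_G(A)$ of an elliptic element of $\tilde W$ has finite order, and for every choice of $\xi$ it has exactly one Kac diagram, whatever choice of $\lambda$ is made; this diagram is the diagram of the $b_k$, that is, all its labels are $1$. -/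

import Mathlib

open scoped MatrixGroups

noncomputable section

namespace KacA

/-! ### The simply connected group `SL_ℓ(ℂ)`, its diagonal torus, and the elements `s_k`

Simple roots are indexed by `Fin (ℓ - 1)`; the index `k` stands for the pair of consecutive
coordinates `lo k`, `hi k`, that is, for the root `e_{lo k} - e_{hi k}`. -/

/-- The first coordinate of the simple root with index `k`. -/
def lo {ℓ : ℕ} (k : Fin (ℓ - 1)) : Fin ℓ := ⟨k, by omega⟩

/-- The second coordinate of the simple root with index `k`. -/
def hi {ℓ : ℕ} (k : Fin (ℓ - 1)) : Fin ℓ := ⟨k + 1, by omega⟩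

theorem lo_ne_hi {ℓ : ℕ} (k : Fin (ℓ - 1)) : lo k ≠ hi k := by
  simp [lo, hi, Fin.ext_iff]

/-- Tuples of non-zero complex numbers with product one. -/
def tuples (ℓ : ℕ) : Subgroup (Fin ℓ → ℂˣ) where
  carrier := {t | ∏ i, t i = 1}
  one_mem' := by simp
  mul_mem' := by
    intro a b ha hb
    simp only [Set.mem_ofPred_eq, Pi.mul_apply, Finset.prod_mul_distrib] at *
    rw [ha, hb, one_mul]
  inv_mem' := by
    intro a ha
    simp only [Set.mem_ofPred_eq, Pi.inv_apply, Finset.prod_inv_distrib] at *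
    rw [ha, inv_one]

/-- The diagonal matrix in `SL_ℓ(ℂ)` with the given entries. -/
def diag (ℓ : ℕ) : tuples ℓ →* SL(ℓ, ℂ) where
  toFun t := ⟨Matrix.diagonal fun i => ((t.1 i : ℂˣ) : ℂ), by
    have h : ∏ i, t.1 i = 1 := t.2
    rw [Matrix.det_diagonal, ← Units.coe_prod, h, Units.val_one]⟩
  map_one' := by
    ext i j
    simp [Matrix.one_apply, Matrix.diagonal_apply]
  map_mul' := by
    intro a b
    apply Subtype.ext
    change Matrix.diagonal _ = Matrix.diagonal _ * Matrix.diagonal _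
    rw [Matrix.diagonal_mul_diagonal]
    simp

/-- The matrix `s_k`: it agrees with the identity outside the rows `k`, `k + 1`, and has
the entry `1` at `(k, k + 1)` and the entry `-1` at `(k + 1, k)`. -/
def sMatrix {ℓ : ℕ} (k : Fin (ℓ - 1)) : Matrix (Fin ℓ) (Fin ℓ) ℂ := fun i j =>
  if i = j ∧ i ≠ lo k ∧ i ≠ hi k then 1
  else if i = lo k ∧ j = hi k then 1
  else if i = hi k ∧ j = lo k then -1
  else 0

theorem sMatrix_eq {ℓ : ℕ} (k : Fin (ℓ - 1)) :
    sMatrix k = Matrix.transvection (lo k) (hi k) 1 * Matrix.transvection (hi k) (lo k) (-1) *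
      Matrix.transvection (lo k) (hi k) 1 := by
  have h := lo_ne_hi k
  ext i j
  simp only [Matrix.transvection, add_mul, mul_add, one_mul, mul_one,
    Matrix.single_mul_single_same, Matrix.single_mul_single_of_ne _ _ _ _ h.symm]
  simp only [Matrix.add_apply, Matrix.zero_apply, Matrix.one_apply, Matrix.single_apply, sMatrix]
  grind

theorem det_sMatrix {ℓ : ℕ} (k : Fin (ℓ - 1)) : (sMatrix k).det = 1 := by
  rw [sMatrix_eq, Matrix.det_mul, Matrix.det_mul,
    Matrix.det_transvection_of_ne _ _ (lo_ne_hi k),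
    Matrix.det_transvection_of_ne _ _ (lo_ne_hi k).symm]
  simp

/-- The element `s_k` of `SL_ℓ(ℂ)`. -/
def s {ℓ : ℕ} (k : Fin (ℓ - 1)) : SL(ℓ, ℂ) := ⟨sMatrix k, det_sMatrix k⟩

/-- Interchanging the entries `k` and `k + 1` of a tuple. -/
def swapTuple {ℓ : ℕ} (k : Fin (ℓ - 1)) (t : tuples ℓ) : tuples ℓ :=
  ⟨fun i => t.1 (Equiv.swap (lo k) (hi k) i), by
    have h : ∏ i, t.1 i = 1 := t.2
    change ∏ i, t.1 (Equiv.swap (lo k) (hi k) i) = 1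
    rw [Equiv.prod_comp (Equiv.swap (lo k) (hi k)) t.1, h]⟩

theorem s_mul_diag {ℓ : ℕ} (k : Fin (ℓ - 1)) (t : tuples ℓ) :
    s k * diag ℓ t = diag ℓ (swapTuple k t) * s k := by
  have h := lo_ne_hi k
  apply Subtype.ext
  change sMatrix k * Matrix.diagonal _ = Matrix.diagonal _ * sMatrix k
  ext i j
  simp only [Matrix.mul_diagonal, Matrix.diagonal_mul, swapTuple, sMatrix, Equiv.swap_apply_def]
  grind

/-! ### The group `G`

Let `π : SL_ℓ(ℂ) → G` be surjective with central kernel. -/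

section group

variable {ℓ : ℕ} {G : Type*} [Group G]

/-- The parametrization of the maximal torus of `G` by tuples. -/
def param (π : SL(ℓ, ℂ) →* G) : tuples ℓ →* G := π.comp (diag ℓ)

/-- The maximal torus `A` of `G`: the image of the diagonal matrices. -/
def A (π : SL(ℓ, ℂ) →* G) : Subgroup G := (param π).range

/-- The normalizer `N_G(A)`. -/
abbrev N (π : SL(ℓ, ℂ) →* G) : Subgroup G := Subgroup.normalizer (A π : Set G)

/-- The Weyl group `N_G(A) / A`. -/
abbrev W (π : SL(ℓ, ℂ) →* G) : Type _ := N π ⧸ (A π).subgroupOf (N π)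

theorem map_s_mem (π : SL(ℓ, ℂ) →* G) (k : Fin (ℓ - 1)) : π (s k) ∈ N π := by
  have key : ∀ t, π (s k) * param π t * (π (s k))⁻¹ = param π (swapTuple k t) := by
    intro t
    rw [mul_inv_eq_iff_eq_mul]
    simp only [param, MonoidHom.comp_apply, ← map_mul, s_mul_diag]
  rw [Subgroup.mem_normalizer_iff]
  intro h
  constructor
  · rintro ⟨t, rfl⟩
    exact ⟨swapTuple k t, (key t).symm⟩
  · rintro ⟨t, ht⟩
    refine ⟨swapTuple k t, ?_⟩
    have hsw : swapTuple k (swapTuple k t) = t := by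
      apply Subtype.ext
      funext i
      simp [swapTuple]
    have h2 := key (swapTuple k t)
    rw [hsw, ht] at h2
    exact mul_left_cancel (mul_right_cancel h2)

/-- The simple reflection `w_k` in the Weyl group. -/
def simpleReflection (π : SL(ℓ, ℂ) →* G) (k : Fin (ℓ - 1)) : W π :=
  QuotientGroup.mk ⟨π (s k), map_s_mem π k⟩

/-- The standard parabolic subgroup of the Weyl group attached to a set of simple roots. -/
def parabolic (π : SL(ℓ, ℂ) →* G) (θ : Set (Fin (ℓ - 1))) : Subgroup (W π) :=
  Subgroup.closure (simpleReflection π '' θ)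

/-- An element of the Weyl group is elliptic if its conjugacy class meets no standard parabolic
subgroup attached to a proper subset of the simple roots. -/
def IsElliptic (π : SL(ℓ, ℂ) →* G) (w : W π) : Prop :=
  ∀ θ : Set (Fin (ℓ - 1)), θ ≠ Set.univ → ∀ u : W π, IsConj w u → u ∉ parabolic π θ

/-- The Coxeter element `w_1 w_2 ⋯ w_{ℓ-1}`. -/
def coxeterElement (π : SL(ℓ, ℂ) →* G) : W π :=
  (List.ofFn (simpleReflection π)).prod

/-! ### Characters and cocharacters of `A`

The space `V = X_*(A) ⊗ ℝ` is identified with the hyperplane `∑ x_i = 0` of `ℝ^ℓ`. -/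

/-- `χ` is the algebraic character of `A` that sends the class of `diag(t_1, …, t_ℓ)`
to `∏ t_i ^ e_i`. -/
def IsCharacter (π : SL(ℓ, ℂ) →* G) (χ : A π →* ℂˣ) (e : Fin ℓ → ℤ) : Prop :=
  ∀ t : tuples ℓ, χ ((param π).rangeRestrict t) = ∏ i, t.1 i ^ e i

/-- `c : ℂˣ → A` is an algebraic cocharacter: its composite with every algebraic character
of `A` is of the form `z ↦ z ^ k`. -/
def IsCocharacter (π : SL(ℓ, ℂ) →* G) (c : ℂˣ →* A π) : Prop :=
  ∀ χ e, IsCharacter π χ e → ∃ k : ℤ, ∀ z, χ (c z) = z ^ k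

/-- `v` is the vector of `V` that corresponds to the cocharacter `c`: the pairing of `c`
with a character is the dot product of `v` with the exponents of this character. -/
def IsVectorOf (π : SL(ℓ, ℂ) →* G) (c : ℂˣ →* A π) (v : Fin ℓ → ℝ) : Prop :=
  ∑ i, v i = 0 ∧
    ∀ χ e (k : ℤ), IsCharacter π χ e → (∀ z, χ (c z) = z ^ k) → ∑ i, (e i : ℝ) * v i = k

end group

/-! ### Roots, coweights, the alcove and the constants `b_γ` -/

/-- The vector `e_i - e_j`. -/
def rootVec {ℓ : ℕ} (i j : Fin ℓ) : Fin ℓ → ℤ := Pi.single i 1 - Pi.single j 1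

/-- The simple root with index `k`. -/
def simpleRoot {ℓ : ℕ} (k : Fin (ℓ - 1)) : Fin ℓ → ℤ := rootVec (lo k) (hi k)

/-- The roots are the vectors `e_i - e_j` with `i ≠ j`. -/
def IsRoot {ℓ : ℕ} (β : Fin ℓ → ℤ) : Prop := ∃ i j, i ≠ j ∧ β = rootVec i j

/-- The highest root: it differs from every root by a non-negative combination of
simple roots. -/
def IsHighestRoot {ℓ : ℕ} (β : Fin ℓ → ℤ) : Prop :=
  IsRoot β ∧ ∀ ρ, IsRoot ρ → ∃ a : Fin (ℓ - 1) → ℕ, β - ρ = ∑ k, (a k : ℤ) • simpleRoot k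

/-- The fundamental coweight `e_1 + ⋯ + e_k - (k / ℓ) (e_1 + ⋯ + e_ℓ)` (with `k` counted
from one). -/
def coweight {ℓ : ℕ} (k : Fin (ℓ - 1)) : Fin ℓ → ℝ := fun i =>
  (if i ≤ lo k then 1 else 0) - ((k : ℝ) + 1) / ℓ

/-- The nodes of the affine Dynkin diagram: `some k` is the simple root with index `k`, and
`none` is the affine root `γ_0 = 1 - (highest root)`. -/
abbrev Node (ℓ : ℕ) : Type := Option (Fin (ℓ - 1))

/-- `b` is the labelling of the nodes by the constants `b_γ`: `b_{γ_0} = 1`, and for a simple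
root `γ`, with `c_γ` the coefficient of `γ` in the highest root, the coweight of `γ` takes the
value `b_γ / c_γ` on `γ` and `0` on the other simple roots. -/
def IsB {ℓ : ℕ} (b : Node ℓ → ℕ) : Prop :=
  b none = 1 ∧ ∃ c : Fin (ℓ - 1) → ℕ, (∀ k, 0 < c k) ∧
    IsHighestRoot (∑ k, (c k : ℤ) • simpleRoot k) ∧
    ∀ k j, ∑ i, (simpleRoot j i : ℝ) * coweight k i =
      if k = j then (b (some k) : ℝ) / c k else 0

/-- The fundamental alcove `C`: the points of `V` at which every positive root `e_i - e_j`,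
`i < j`, takes a value strictly between `0` and `1`. -/
def alcove (ℓ : ℕ) : Set (Fin ℓ → ℝ) :=
  {x | ∑ i, x i = 0 ∧ ∀ i j, i < j → 0 < x i - x j ∧ x i - x j < 1}

/-- The vertices of the alcove: `v_{γ_0} = 0`, and `v_γ` is the coweight of `γ` divided
by `b_γ`. -/
def vertex {ℓ : ℕ} (b : Node ℓ → ℕ) : Node ℓ → Fin ℓ → ℝ
  | none => 0
  | some k => (b (some k) : ℝ)⁻¹ • coweight k

/-- `σ` is a Kac diagram of the element `g` of `G`, relative to the root of unity `ξ` (which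
has to be primitive of order `m = orderOf g`).  There is a cocharacter `c` of `A` such that `g`
is conjugate to `c ξ` and `x = c / m` lies in the closure of the alcove, and there are
non-negative integers `τ γ` with `m = ∑ τ γ * b γ` and `x = (1 / m) ∑ τ γ * b γ * v_γ`, from which
`σ` arises by removing the common factor. -/
def IsKacDiagram {ℓ : ℕ} {G : Type*} [Group G] (π : SL(ℓ, ℂ) →* G) (b : Node ℓ → ℕ)
    (ξ : ℂˣ) (g : G) (σ : Node ℓ → ℕ) : Prop :=
  ∃ (c : ℂˣ →* A π) (v x : Fin ℓ → ℝ) (τ : Node ℓ → ℕ),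
    IsCocharacter π c ∧ IsVectorOf π c v ∧
    IsConj g (c ξ : G) ∧
    x = (orderOf g : ℝ)⁻¹ • v ∧ x ∈ closure (alcove ℓ) ∧
    orderOf g = ∑ γ, τ γ * b γ ∧
    x = (orderOf g : ℝ)⁻¹ • ∑ γ, ((τ γ * b γ : ℕ) : ℝ) • vertex b γ ∧
    (∃ d : ℕ, 0 < d ∧ ∀ γ, τ γ = d * σ γ) ∧ Finset.univ.gcd σ = 1

end KacA

end

/-!
The Weyl group is the symmetric group on `ℓ` letters with its adjacent transpositions. A permutation
is conjugate into a proper standard parabolic subgroup if and only if it stabilizes a proper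
non-empty set, so the elliptic elements are the `ℓ`-cycles.

A lift of an `ℓ`-cycle to `SL_ℓ(ℂ)` is a monomial matrix. Apart from the identity, only the cycle
itself contributes to the Leibniz expansion of its characteristic polynomial, which is therefore
`X ^ ℓ + (-1) ^ ℓ`. Hence a torus element is conjugate to the lift in `G` if and only if its entries
are pairwise distinct with equal `ℓ`-th powers. If the lift has order `ℓ * d` in `G`, this says that
all roots take values in `d * ℤ`, but not in `ℓ * d * ℤ`, at the cocharacter; so the labels
`τ γ` are positive multiples of `d` with sum `ℓ * d`, and each of them is `d`. Conversely, with `2ρ`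
the sum of the positive coroots, `d * ρ` is a cocharacter of `A`, because the `ℓ`-th power of the
lift is the value of `2ρ` at `-1`.
-/

namespace KacA

/-! ### Permutations that are a single cycle -/

section permutations

open Equiv Equiv.Perm MulAction
open scoped Pointwise

variable {α : Type*} {p q : Perm α}

theorem isCycleOn_univ_iff_stabilizer :
    p.IsCycleOn Set.univ ↔ ∀ S : Set α, p ∈ stabilizer (Perm α) S → S = ∅ ∨ S = Set.univ := by
  constructor
  · intro hp S hS
    refine S.eq_empty_or_nonempty.imp_right fun ⟨x, hx⟩ => Set.eq_univ_of_forall fun y => ?_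
    obtain ⟨n, rfl⟩ := hp.2 (Set.mem_univ x) (Set.mem_univ y)
    exact (mem_stabilizer_set.1 (zpow_mem hS n) x).2 hx
  · intro h
    refine ⟨p.bijective.bijOn_univ, fun x _ y _ => ?_⟩
    have hS : p ∈ stabilizer (Perm α) {z | p.SameCycle x z} :=
      mem_stabilizer_set.2 fun z => sameCycle_apply_right
    have hx : x ∈ {z | p.SameCycle x z} := SameCycle.refl p x
    exact Set.eq_univ_iff_forall.1 ((h _ hS).resolve_left (Set.Nonempty.ne_empty ⟨x, hx⟩)) y

theorem isConj_iff_isCycleOn_univ [Finite α] (hp : p.IsCycleOn Set.univ) :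
    IsConj p q ↔ q.IsCycleOn Set.univ := by
  classical
  constructor
  · intro h
    obtain ⟨g, rfl⟩ := isConj_iff.1 h
    simpa using hp.conj (g := g)
  · intro hq
    have := Fintype.ofFinite α
    rcases subsingleton_or_nontrivial α with hα | hα
    · rw [Subsingleton.elim p q]
    · have support_eq_univ {r : Perm α} (hr : r.IsCycleOn Set.univ) : r.support = Finset.univ :=
        Finset.eq_univ_of_forall fun i =>
          mem_support.2 (hr.apply_ne Set.nontrivial_univ (Set.mem_univ i))
      have isCycle {r : Perm α} (hr : r.IsCycleOn Set.univ) : r.IsCycle :=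
        isCycle_iff_exists_isCycleOn.2 ⟨_, Set.nontrivial_univ, hr, fun _ _ => Set.mem_univ _⟩
      exact (isCycle hp).isConj (isCycle hq) (by rw [support_eq_univ hp, support_eq_univ hq])

theorem exists_smul_set_eq [Finite α] {S T : Set α} (h : S.ncard = T.ncard) :
    ∃ g : Perm α, g • S = T := by
  classical
  have := Fintype.ofFinite α
  obtain ⟨e⟩ : Nonempty (S ≃ T) := Finite.card_eq.1 h
  refine ⟨e.extendSubtype, Set.eq_of_subset_of_ncard_le ?_ (by rw [Set.ncard_smul_set, h])⟩
  rintro _ ⟨x, hx, rfl⟩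
  exact e.extendSubtype_mem x hx

theorem eq_one_or_eq_of_isCycleOn_univ [Finite α] (hp : p.IsCycleOn Set.univ)
    (h : ∀ i, q i = i ∨ q i = p i) : q = 1 ∨ q = p := by
  have hstab : p ∈ stabilizer (Perm α) {i | q i ≠ i} := by
    refine (mem_stabilizer_set' (Set.toFinite _)).2 fun i hi hpi => ?_
    have hqi : q i = p i := (h i).resolve_left hi
    exact hi (hqi.trans (q.injective (hpi.trans hqi.symm)))
  rcases isCycleOn_univ_iff_stabilizer.1 hp _ hstab with hS | hS
  · exact Or.inl (Equiv.ext fun i => not_not.1 (Set.eq_empty_iff_forall_notMem.1 hS i))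
  · exact Or.inr (Equiv.ext fun i => (h i).resolve_left (Set.eq_univ_iff_forall.1 hS i))

end permutations

section adjSwap

open Equiv Equiv.Perm MulAction
open scoped Pointwise

variable {ℓ : ℕ}

/-- The transposition of the coordinates `lo k` and `hi k`, that is, the simple reflection `w_k`
under the identification of the Weyl group with the symmetric group. -/
def adjSwap (k : Fin (ℓ - 1)) : Perm (Fin ℓ) := swap (lo k) (hi k)

theorem prod_adjSwap : (List.ofFn (adjSwap (ℓ := ℓ))).prod = (List.finRange ℓ).formPerm := by
  have h : List.ofFn (adjSwap (ℓ := ℓ)) =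
      List.zipWith swap (List.finRange ℓ) (List.finRange ℓ).tail :=
    List.ext_getElem (by simp) fun i _ _ => by simp [adjSwap, lo, hi]
  rw [h]
  rfl

theorem isCycleOn_univ_prod_adjSwap : (List.ofFn (adjSwap (ℓ := ℓ))).prod.IsCycleOn Set.univ := by
  rw [prod_adjSwap]
  simpa using (List.nodup_finRange ℓ).isCycleOn_formPerm

theorem mem_orbit_of_adjSwap_mem {H : Subgroup (Perm (Fin ℓ))} {a b : Fin ℓ} (hab : a ≤ b)
    (hH : ∀ j : Fin (ℓ - 1), a ≤ lo j → hi j ≤ b → adjSwap j ∈ H) : b ∈ orbit H a := by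
  obtain ⟨b, hb⟩ := b
  induction b, (show (a : ℕ) ≤ b from hab) using Nat.le_induction with
  | base => exact mem_orbit_self a
  | succ b hab' ih =>
    let j : Fin (ℓ - 1) := ⟨b, by omega⟩
    have hlo : lo j ∈ orbit H a :=
      ih (by omega) hab' fun i hai hib => hH i hai (hib.trans (Nat.le_succ b))
    rw [← orbit_eq_iff.2 hlo]
    exact ⟨⟨adjSwap j, hH j hab' le_rfl⟩, swap_apply_left _ _⟩

theorem mem_closure_adjSwap {θ : Set (Fin (ℓ - 1))} {p : Perm (Fin ℓ)}
    (h : ∀ x j, min x (p x) ≤ lo j → hi j ≤ max x (p x) → j ∈ θ) :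
    p ∈ Subgroup.closure (adjSwap '' θ) := by
  have hswap : ∀ f ∈ adjSwap '' θ, f.IsSwap := by
    rintro _ ⟨j, -, rfl⟩
    exact ⟨_, _, lo_ne_hi j, rfl⟩
  refine (mem_closure_isSwap hswap).2 ⟨Set.toFinite _, fun x => ?_⟩
  have hmax : max x (p x) ∈ orbit (Subgroup.closure (adjSwap '' θ)) (min x (p x)) :=
    mem_orbit_of_adjSwap_mem min_le_max fun j hj hj' =>
      Subgroup.subset_closure ⟨j, h x j hj hj', rfl⟩
  rcases le_total x (p x) with hx | hx
  · rwa [min_eq_left hx, max_eq_right hx] at hmax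
  · rw [min_eq_right hx, max_eq_left hx] at hmax
    exact mem_orbit_symm.1 hmax

theorem closure_range_adjSwap : Subgroup.closure (Set.range (adjSwap (ℓ := ℓ))) = ⊤ := by
  rw [eq_top_iff, ← Set.image_univ]
  exact fun p _ => mem_closure_adjSwap fun _ j _ _ => Set.mem_univ j

theorem adjSwap_apply_le_lo_iff {j k : Fin (ℓ - 1)} (h : j ≠ k) (i : Fin ℓ) :
    adjSwap j i ≤ lo k ↔ i ≤ lo k := by
  rw [adjSwap, swap_apply_def]
  simp only [lo, hi, Fin.ext_iff, Fin.le_def, ne_eq] at *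
  split_ifs <;> simp only <;> omega

theorem closure_adjSwap_compl_singleton (k : Fin (ℓ - 1)) :
    Subgroup.closure (adjSwap '' {k}ᶜ) = stabilizer (Perm (Fin ℓ)) (Set.Iic (lo k)) := by
  apply le_antisymm
  · rw [Subgroup.closure_le]
    rintro _ ⟨j, hj, rfl⟩
    exact mem_stabilizer_set.2 (adjSwap_apply_le_lo_iff hj)
  · intro p hp
    refine mem_closure_adjSwap fun x j hlo hhi hj => ?_
    have hx : p x ≤ lo k ↔ x ≤ lo k := mem_stabilizer_set.1 hp x
    rw [hj] at hlo hhi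
    simp only [lo, hi, Fin.le_def, min_le_iff, le_max_iff] at *
    omega

theorem notMem_closure_adjSwap {p : Perm (Fin ℓ)} (hp : p.IsCycleOn Set.univ)
    {θ : Set (Fin (ℓ - 1))} (hθ : θ ≠ Set.univ) : p ∉ Subgroup.closure (adjSwap '' θ) := by
  obtain ⟨k, hk⟩ := (Set.ne_univ_iff_exists_notMem θ).1 hθ
  intro hmem
  have hstab : p ∈ stabilizer (Perm (Fin ℓ)) (Set.Iic (lo k)) := by
    rw [← closure_adjSwap_compl_singleton]
    exact Subgroup.closure_mono (Set.image_mono (Set.subset_compl_singleton_iff.2 hk)) hmem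
  rcases isCycleOn_univ_iff_stabilizer.1 hp _ hstab with h | h
  · exact Set.nonempty_Iic.ne_empty h
  · have : hi k ≤ lo k := Set.eq_univ_iff_forall.1 h (hi k)
    simp [lo, hi, Fin.le_def] at this

theorem exists_isConj_mem_closure_adjSwap {p : Perm (Fin ℓ)} (hp : ¬ p.IsCycleOn Set.univ) :
    ∃ k : Fin (ℓ - 1), ∃ u, IsConj p u ∧ u ∈ Subgroup.closure (adjSwap '' {k}ᶜ) := by
  rw [isCycleOn_univ_iff_stabilizer] at hp
  push Not at hp
  obtain ⟨S, hpS, hne, huniv⟩ := hp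
  have hpos : 0 < S.ncard := S.ncard_pos.2 hne
  have hlt : S.ncard < ℓ := by simpa using Set.ncard_lt_card huniv
  let k : Fin (ℓ - 1) := ⟨S.ncard - 1, by omega⟩
  obtain ⟨g, hg⟩ : ∃ g : Perm (Fin ℓ), g • S = Set.Iic (lo k) := by
    apply exists_smul_set_eq
    rw [← Finset.coe_Iic, Set.ncard_coe_finset, Fin.card_Iic]
    simp only [lo, k]
    omega
  refine ⟨k, g * p * g⁻¹, isConj_iff.2 ⟨g, rfl⟩, ?_⟩
  rw [closure_adjSwap_compl_singleton, ← hg, stabilizer_smul_eq_stabilizer_map_conj]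
  exact ⟨p, hpS, rfl⟩

end adjSwap

/-! ### Monomial matrices -/

section monomial

open Equiv Matrix

variable {ι R : Type*} {M M' : Matrix ι ι R} {p q : Perm ι}

/-- `M` is a monomial matrix over the permutation `p`: its non-zero entries are exactly those in
the places `(p j, j)`. -/
def IsMonomial [Zero R] (M : Matrix ι ι R) (p : Perm ι) : Prop :=
  ∀ i j, M i j ≠ 0 ↔ i = p j

theorem IsMonomial.unique [Zero R] (hp : IsMonomial M p) (hq : IsMonomial M q) : p = q :=
  Equiv.ext fun j => (hq _ j).1 ((hp _ j).2 rfl)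

theorem IsMonomial.mul [Fintype ι] [NonUnitalNonAssocSemiring R] [NoZeroDivisors R]
    (hp : IsMonomial M p) (hq : IsMonomial M' q) : IsMonomial (M * M') (p * q) := by
  intro i j
  have h : (M * M') i j = M i (q j) * M' (q j) j := by
    rw [Matrix.mul_apply]
    refine Fintype.sum_eq_single _ fun k hk => ?_
    rw [not_not.1 (mt (hq k j).1 hk), mul_zero]
  rw [h, mul_ne_zero_iff, hp, hq, Perm.mul_apply]
  exact and_iff_left rfl

theorem isMonomial_one_iff [DecidableEq ι] [Zero R] :
    IsMonomial M 1 ↔ ∃ t : ι → R, (∀ i, t i ≠ 0) ∧ M = diagonal t := by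
  constructor
  · refine fun h => ⟨fun i => M i i, fun i => (h i i).2 rfl, ?_⟩
    ext i j
    rw [diagonal_apply]
    split_ifs with hij
    · rw [hij]
    · exact not_not.1 (mt (h i j).1 hij)
  · rintro ⟨t, ht, rfl⟩ i j
    rw [diagonal_apply]
    aesop

theorem exists_isMonomial_of_mul_diagonal_eq [Fintype ι] [DecidableEq ι] [CommRing R] [IsDomain R]
    {t t' : ι → R} (hM : IsUnit M) (ht : Function.Injective t)
    (h : M * diagonal t = diagonal t' * M) : ∃ p, IsMonomial M p := by
  have hdet : M.det ≠ 0 := ((isUnit_iff_isUnit_det M).1 hM).ne_zero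
  have hrow : ∀ i, ∃ j, M i j ≠ 0 := fun i => by
    by_contra! hc
    exact hdet (det_eq_zero_of_row_eq_zero i hc)
  have hcol : ∀ j, ∃ i, M i j ≠ 0 := fun j => by
    by_contra! hc
    exact hdet (det_eq_zero_of_column_eq_zero j hc)
  have hent : ∀ i j, M i j ≠ 0 → t j = t' i := fun i j hij => by
    have hij' : M i j * t j = t' i * M i j := by
      simpa only [mul_diagonal, diagonal_mul] using congrFun (congrFun h i) j
    exact mul_right_cancel₀ hij ((mul_comm _ _).trans hij')
  choose q hq using hrow
  have huniq : ∀ i j, M i j ≠ 0 → j = q i := fun i j hij =>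
    ht ((hent i j hij).trans (hent i _ (hq i)).symm)
  have hsurj : Function.Surjective q := fun j =>
    (hcol j).imp fun i hi => (huniq i j hi).symm
  refine ⟨(Equiv.ofBijective q (Finite.surjective_iff_bijective.1 hsurj))⁻¹, fun i j => ?_⟩
  rw [Perm.eq_inv_iff_eq]
  refine ⟨fun hij => (huniq i j hij).symm, ?_⟩
  rintro rfl
  exact hq i

end monomial

section charpoly

open Equiv Equiv.Perm Matrix Polynomial

variable {ι R : Type*} [Fintype ι] [DecidableEq ι] [CommRing R] {M : Matrix ι ι R} {p : Perm ι}

/-- In the Leibniz expansion of `det (X - M)` only the identity and `p` contribute. -/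
theorem charpoly_eq_X_pow_sub_C [Nontrivial ι] (hM : ∀ i j, M i j ≠ 0 → i = p j)
    (hp : p.IsCycleOn Set.univ) :
    M.charpoly = X ^ Fintype.card ι - C ((-1) ^ (Fintype.card ι + 1) * M.det) := by
  have hne (i : ι) : p i ≠ i := hp.apply_ne Set.nontrivial_univ (Set.mem_univ i)
  have hzero {i j : ι} (hij : i ≠ p j) : M i j = 0 := not_not.1 (mt (hM i j) hij)
  have h1p : (1 : Perm ι) ≠ p := by
    rintro rfl
    exact hne (Classical.arbitrary ι) rfl
  obtain ⟨a, ha⟩ : ∃ a, M.charpoly = X ^ Fintype.card ι + C a := by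
    refine ⟨sign p • ∏ i, -M (p i) i, ?_⟩
    rw [charpoly, det_apply, Fintype.sum_eq_add 1 p h1p]
    · congr 1
      · simp [hzero (hne _).symm]
      · simp [hne, Units.smul_def, zsmul_eq_mul]
    · rintro τ ⟨hτ1, hτp⟩
      obtain ⟨i, hi⟩ : ∃ i, ¬ (τ i = i ∨ τ i = p i) := by
        by_contra! h
        exact (eq_one_or_eq_of_isCycleOn_univ hp h).elim hτ1 hτp
      rw [not_or] at hi
      rw [Finset.prod_eq_zero (Finset.mem_univ i), smul_zero]
      rw [charmatrix_apply, diagonal_apply_ne _ hi.1, hzero hi.2, map_zero, sub_zero]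
  have hcoeff : M.charpoly.coeff 0 = a := by
    simp [ha, Fintype.card_ne_zero.symm]
  rw [ha, det_eq_sign_charpoly_coeff, hcoeff, ← mul_assoc, ← pow_add, sub_eq_add_neg, ← C_neg]
  have hodd : Odd (Fintype.card ι + 1 + Fintype.card ι) := ⟨Fintype.card ι, by ring⟩
  rw [hodd.neg_one_pow, neg_one_mul, neg_neg]

theorem pow_card_of_det_eq_one [Nontrivial ι] (hM : ∀ i j, M i j ≠ 0 → i = p j)
    (hp : p.IsCycleOn Set.univ) (hdet : M.det = 1) :
    M ^ Fintype.card ι = scalar ι ((-1) ^ (Fintype.card ι + 1)) := by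
  have h := aeval_self_charpoly M
  rw [charpoly_eq_X_pow_sub_C hM hp, hdet, mul_one, map_sub, map_pow, aeval_X, aeval_C] at h
  exact sub_eq_zero.1 h

end charpoly

section diagonalization

open Matrix Polynomial

variable {ι K : Type*} [Fintype ι] [Field K] {t : ι → K}

theorem prod_X_sub_C_eq_X_pow_sub_C [Nonempty ι] {a : K} (ht : Function.Injective t)
    (hta : ∀ i, t i ^ Fintype.card ι = a) :
    ∏ i, (X - C (t i)) = X ^ Fintype.card ι - C a := by
  refine (eq_of_monic_of_dvd_of_natDegree_le (monic_prod_X_sub_C t _)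
    (monic_X_pow_sub_C a Fintype.card_ne_zero) ?_ ?_).symm
  · exact Fintype.prod_dvd_of_coprime (pairwise_coprime_X_sub_C ht) fun i =>
      dvd_iff_isRoot.2 (by simp [hta])
  · rw [natDegree_X_pow_sub_C, natDegree_finsetProd_X_sub_C_eq_card, Finset.card_univ]

theorem eq_neg_one_pow_mul_prod_of_pow_eq [Nonempty ι] {a : K} (ht : Function.Injective t)
    (hta : ∀ i, t i ^ Fintype.card ι = a) : a = (-1) ^ (Fintype.card ι + 1) * ∏ i, t i := by
  have h : (-1) ^ Fintype.card ι * ∏ i, t i = -a := by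
    simpa [eval_prod, Finset.prod_neg] using
      congrArg (eval 0) (prod_X_sub_C_eq_X_pow_sub_C ht hta)
  rw [pow_succ, mul_neg_one, neg_mul, h, neg_neg]

theorem prod_X_sub_C_eq_X_pow_sub_C_iff (hcard : (Fintype.card ι : K) ≠ 0) (ht : ∀ i, t i ≠ 0) :
    ∏ i, (X - C (t i)) = X ^ Fintype.card ι - C ((-1) ^ (Fintype.card ι + 1) * ∏ i, t i) ↔
      Function.Injective t ∧ ∀ i j, t i ^ Fintype.card ι = t j ^ Fintype.card ι := by
  constructor
  · intro h
    have hroot (i : ι) : t i ^ Fintype.card ι = (-1) ^ (Fintype.card ι + 1) * ∏ i, t i := by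
      have hi : (∏ i, (X - C (t i))).eval (t i) = 0 := by
        rw [eval_prod]
        exact Finset.prod_eq_zero (Finset.mem_univ i) (by simp)
      rw [h] at hi
      simpa only [eval_sub, eval_pow, eval_X, eval_C, sub_eq_zero] using hi
    have hconst : (-1) ^ (Fintype.card ι + 1) * ∏ i, t i ≠ 0 :=
      mul_ne_zero (pow_ne_zero _ (neg_ne_zero.2 one_ne_zero))
        (Finset.prod_ne_zero_iff.2 fun i _ => ht i)
    exact ⟨(h ▸ separable_X_pow_sub_C _ hcard hconst).injective_of_prod_X_sub_C,
      fun i j => (hroot i).trans (hroot j).symm⟩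
  · rintro ⟨hinj, hpow⟩
    have : Nonempty ι := Fintype.card_pos_iff.1 (Nat.pos_of_ne_zero fun h => hcard (by simp [h]))
    let i := Classical.arbitrary ι
    rw [← eq_neg_one_pow_mul_prod_of_pow_eq hinj fun j => hpow j i]
    exact prod_X_sub_C_eq_X_pow_sub_C hinj fun j => hpow j i

variable [DecidableEq ι]

theorem exists_isUnit_mul_eq_mul_diagonal {M : Matrix ι ι K} (ht : Function.Injective t)
    (hroot : ∀ i, M.charpoly.IsRoot (t i)) :
    ∃ P : Matrix ι ι K, IsUnit P ∧ M * P = P * diagonal t := by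
  have heig (i : ι) : Module.End.HasEigenvalue (toLin' M) (t i) := by
    rw [Module.End.hasEigenvalue_iff_isRoot_charpoly, charpoly_toLin']
    exact hroot i
  choose x hx using fun i => (heig i).exists_hasEigenvector
  refine ⟨(of x)ᵀ, linearIndependent_cols_iff_isUnit.1
    (Module.End.eigenvectors_linearIndependent' (toLin' M) t ht x hx), ?_⟩
  ext i j
  have hij : (M *ᵥ x j) i = t j * x j i := by
    simpa using congrFun (hx j).apply_eq_smul i
  rw [mul_diagonal, transpose_apply, of_apply, mul_comm, ← hij]
  rfl

theorem isConj_of_isUnit_of_mul_eq_mul [IsAlgClosed K] [Nonempty ι] {M D : SpecialLinearGroup ι K}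
    {P : Matrix ι ι K} (hP : IsUnit P) (h : (M : Matrix ι ι K) * P = P * D) : IsConj M D := by
  have hdet : P.det ≠ 0 := ((isUnit_iff_isUnit_det P).1 hP).ne_zero
  obtain ⟨δ, hδ⟩ := IsAlgClosed.exists_pow_nat_eq P.det⁻¹ (Fintype.card_pos (α := ι))
  let Q : SpecialLinearGroup ι K :=
    ⟨δ • P, by rw [det_smul, hδ, inv_mul_cancel₀ hdet]⟩
  refine IsConj.symm (isConj_iff.2 ⟨Q, mul_inv_eq_of_eq_mul (Subtype.ext ?_)⟩)
  change (δ • P) * (D : Matrix ι ι K) = M * (δ • P)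
  rw [Matrix.mul_smul, h, Matrix.smul_mul]

theorem charpoly_eq_of_isConj {M D : SpecialLinearGroup ι K} (h : IsConj M D) :
    (M : Matrix ι ι K).charpoly = (D : Matrix ι ι K).charpoly := by
  obtain ⟨g, rfl⟩ := isConj_iff.1 h
  have hM : (g⁻¹ * (g * M)).1 = M.1 := by rw [inv_mul_cancel_left]
  rw [← hM]
  exact charpoly_mul_comm g⁻¹.1 (g * M).1

end diagonalization

/-! ### The diagonal torus of `SL_ℓ(ℂ)` -/

section torus

open Matrix Polynomial

variable {ℓ : ℕ}

theorem prod_zpow_eq_zpow_sum {ι H : Type*} [CommGroup H] (s : Finset ι) (f : ι → ℤ) (y : H) :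
    ∏ i ∈ s, y ^ f i = y ^ ∑ i ∈ s, f i :=
  (map_sum (zpowersHom H y).toAdditiveRight f s).symm

theorem exists_zpow_injective : ∃ u : ℂˣ, Function.Injective fun k : ℤ => u ^ k := by
  refine ⟨Units.mk0 2 two_ne_zero, fun k k' h => ?_⟩
  have hnorm : (2 : ℝ) ^ k = 2 ^ k' := by
    simpa using congrArg (fun u : ℂˣ => ‖(u : ℂ)‖) h
  exact zpow_right_injective₀ two_pos (by norm_num) hnorm

/-- The one-parameter family of tuples `y ↦ (y ^ f i)`, that is, the cocharacter of the diagonal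
torus of `SL_ℓ(ℂ)` with exponents `f`. -/
def zpowTuple (f : Fin ℓ → ℤ) (hf : ∑ i, f i = 0) : ℂˣ →* tuples ℓ where
  toFun y := ⟨fun i => y ^ f i, show ∏ i, y ^ f i = 1 by
    rw [prod_zpow_eq_zpow_sum, hf, zpow_zero]⟩
  map_one' := Subtype.ext (funext fun i => one_zpow (f i))
  map_mul' a b := Subtype.ext (funext fun i => mul_zpow a b (f i))

/-- The exponents of the sum `2ρ` of the positive coroots. -/
def twoRho (i : Fin ℓ) : ℤ := ℓ - 1 - 2 * (i : ℤ)

theorem sum_twoRho : ∑ i : Fin ℓ, twoRho i = 0 := by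
  have h : ∑ i : Fin ℓ, twoRho i = -∑ i : Fin ℓ, twoRho i := by
    rw [← Finset.sum_neg_distrib, ← Equiv.sum_comp Fin.revPerm]
    refine Finset.sum_congr rfl fun i _ => ?_
    simp only [twoRho, Fin.revPerm_apply, Fin.val_rev]
    omega
  exact self_eq_neg.1 h

theorem exists_injective_tuple (ℓ : ℕ) : ∃ t : tuples ℓ, Function.Injective t.1 := by
  obtain ⟨u, hu⟩ := exists_zpow_injective
  refine ⟨zpowTuple twoRho sum_twoRho u, fun i j h => ?_⟩
  have hij : twoRho i = twoRho j := hu h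
  unfold twoRho at hij
  exact Fin.ext (by omega)

theorem mem_range_diag_iff {M : SL(ℓ, ℂ)} : M ∈ (diag ℓ).range ↔ IsMonomial M.1 1 := by
  rw [isMonomial_one_iff]
  constructor
  · rintro ⟨t, rfl⟩
    exact ⟨fun i => t.1 i, fun i => (t.1 i).ne_zero, rfl⟩
  · rintro ⟨t, ht0, hM⟩
    have hprod : ∏ i, t i = 1 := by rw [← det_diagonal, ← hM, M.2]
    exact ⟨⟨fun i => Units.mk0 (t i) (ht0 i), Units.ext (by simpa using hprod)⟩,
      Subtype.ext hM.symm⟩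

theorem isMonomial_s (k : Fin (ℓ - 1)) : IsMonomial (s k).1 (adjSwap k) := by
  intro i j
  have h := lo_ne_hi k
  simp only [s, sMatrix, adjSwap, Equiv.swap_apply_def]
  grind

theorem center_le_range_diag : Subgroup.center SL(ℓ, ℂ) ≤ (diag ℓ).range := by
  intro z hz
  obtain ⟨r, hr, hz⟩ := Matrix.SpecialLinearGroup.mem_center_iff.1 hz
  refine mem_range_diag_iff.2 (isMonomial_one_iff.2 ⟨fun _ => r, fun i => ?_, hz.symm⟩)
  have : Nonempty (Fin ℓ) := ⟨i⟩
  rintro rfl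
  exact zero_ne_one ((zero_pow Fintype.card_ne_zero).symm.trans hr)

theorem isConj_diag_iff (hℓ : 2 ≤ ℓ) {M : SL(ℓ, ℂ)} {p : Equiv.Perm (Fin ℓ)}
    (hM : IsMonomial M.1 p) (hp : p.IsCycleOn Set.univ) (t : tuples ℓ) :
    IsConj M (diag ℓ t) ↔ Function.Injective t.1 ∧ ∀ i j, t.1 i ^ ℓ = t.1 j ^ ℓ := by
  have : Nontrivial (Fin ℓ) := Fin.nontrivial_iff_two_le.2 hℓ
  have hprod : ∏ i, ((t.1 i : ℂˣ) : ℂ) = 1 := by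
    rw [← det_diagonal]
    exact (diag ℓ t).2
  have hcharM := charpoly_eq_X_pow_sub_C (fun i j => (hM i j).1) hp
  have hchart : (diag ℓ t).1.charpoly = ∏ i, (X - C ((t.1 i : ℂˣ) : ℂ)) := charpoly_diagonal _
  have hiff := prod_X_sub_C_eq_X_pow_sub_C_iff (t := fun i => ((t.1 i : ℂˣ) : ℂ))
    (by simpa using (show ℓ ≠ 0 by omega)) fun i => (t.1 i).ne_zero
  rw [M.2, mul_one] at hcharM
  rw [hprod, mul_one, ← hcharM, ← hchart, Fintype.card_fin] at hiff
  have hiff' : (diag ℓ t).1.charpoly = M.1.charpoly ↔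
      Function.Injective t.1 ∧ ∀ i j, t.1 i ^ ℓ = t.1 j ^ ℓ :=
    hiff.trans (and_congr (Units.val_injective.of_comp_iff t.1)
      (forall₂_congr fun i j => by simp only [Units.ext_iff, Units.val_pow_eq_pow_val]))
  refine ⟨fun h => hiff'.1 (charpoly_eq_of_isConj h).symm, fun h => ?_⟩
  obtain ⟨P, hP, hMP⟩ := exists_isUnit_mul_eq_mul_diagonal (M := M.1)
    (Units.val_injective.comp h.1) fun i => by
      rw [← hiff'.2 h, hchart, IsRoot.def, eval_prod]
      exact Finset.prod_eq_zero (Finset.mem_univ i) (by simp)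
  exact isConj_of_isUnit_of_mul_eq_mul hP hMP

end torus

/-! ### The Weyl group is the symmetric group -/

section weyl

open Matrix

variable {ℓ : ℕ} {G : Type*} [Group G] {π : SL(ℓ, ℂ) →* G}

theorem map_mem_A_iff (hker : π.ker ≤ Subgroup.center SL(ℓ, ℂ)) {M : SL(ℓ, ℂ)} :
    π M ∈ A π ↔ M ∈ (diag ℓ).range := by
  rw [A, param, MonoidHom.range_comp, ← Subgroup.mem_comap,
    Subgroup.comap_map_eq_self (hker.trans center_le_range_diag)]

theorem exists_isMonomial_of_map_mem_N (hker : π.ker ≤ Subgroup.center SL(ℓ, ℂ)) {M : SL(ℓ, ℂ)}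
    (hM : π M ∈ N π) : ∃ p, IsMonomial M.1 p := by
  obtain ⟨t, ht⟩ := exists_injective_tuple ℓ
  obtain ⟨t', ht'⟩ : M * diag ℓ t * M⁻¹ ∈ (diag ℓ).range := by
    rw [← map_mem_A_iff hker, map_mul, map_mul, map_inv]
    exact (Subgroup.mem_normalizer_iff.1 hM _).1 ⟨t, rfl⟩
  refine exists_isMonomial_of_mul_diagonal_eq (t := fun i => ((t.1 i : ℂˣ) : ℂ))
    (t' := fun i => ((t'.1 i : ℂˣ) : ℂ)) ?_ (Units.val_injective.comp ht) ?_
  · exact (isUnit_iff_isUnit_det _).2 (by rw [M.2]; exact isUnit_one)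
  · have h : M * diag ℓ t = diag ℓ t' * M := by rw [ht', inv_mul_cancel_right]
    exact congrArg Subtype.val h

theorem exists_forall_isMonomial (hsurj : Function.Surjective π)
    (hker : π.ker ≤ Subgroup.center SL(ℓ, ℂ)) (n : N π) :
    ∃ p, ∀ M, π M = n → IsMonomial M.1 p := by
  obtain ⟨M, hM⟩ := hsurj n
  obtain ⟨p, hp⟩ := exists_isMonomial_of_map_mem_N hker (hM ▸ n.2)
  refine ⟨p, fun M' hM' => ?_⟩
  have hz : M⁻¹ * M' ∈ π.ker := by
    rw [MonoidHom.mem_ker, map_mul, map_inv, hM, hM', inv_mul_cancel]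
  have hM'_eq : M.1 * (M⁻¹ * M').1 = M'.1 := congrArg Subtype.val (mul_inv_cancel_left M M')
  have h := hp.mul (mem_range_diag_iff.1 (center_le_range_diag (hker hz)))
  rwa [mul_one, hM'_eq] at h

variable (hsurj : Function.Surjective π) (hker : π.ker ≤ Subgroup.center SL(ℓ, ℂ))

/-- The permutation of the coordinates defined by an element `n` of `N_G(A)`: all preimages of `n`
in `SL_ℓ(ℂ)` are monomial matrices over it. -/
noncomputable def permHom : N π →* Equiv.Perm (Fin ℓ) :=
  MonoidHom.mk' (fun n => (exists_forall_isMonomial hsurj hker n).choose) fun a b => by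
    obtain ⟨x, hx⟩ := hsurj a
    obtain ⟨y, hy⟩ := hsurj b
    have ha := (exists_forall_isMonomial hsurj hker a).choose_spec x hx
    have hb := (exists_forall_isMonomial hsurj hker b).choose_spec y hy
    have hab := (exists_forall_isMonomial hsurj hker (a * b)).choose_spec (x * y)
      (by rw [map_mul, hx, hy, Subgroup.coe_mul])
    exact hab.unique (ha.mul hb)

theorem isMonomial_permHom {n : N π} {M : SL(ℓ, ℂ)} (h : π M = n) :
    IsMonomial M.1 (permHom hsurj hker n) :=
  (exists_forall_isMonomial hsurj hker n).choose_spec M h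

theorem permHom_s (k : Fin (ℓ - 1)) :
    permHom hsurj hker ⟨π (s k), map_s_mem π k⟩ = adjSwap k :=
  (isMonomial_permHom hsurj hker rfl).unique (isMonomial_s k)

theorem ker_permHom : (permHom hsurj hker).ker = (A π).subgroupOf (N π) := by
  ext n
  obtain ⟨M, hM⟩ := hsurj n
  have hmon := isMonomial_permHom hsurj hker hM
  rw [MonoidHom.mem_ker, Subgroup.mem_subgroupOf, ← hM, map_mem_A_iff hker, mem_range_diag_iff]
  exact ⟨fun h => h ▸ hmon, hmon.unique⟩

theorem permHom_surjective : Function.Surjective (permHom hsurj hker) := by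
  rw [← MonoidHom.range_eq_top, eq_top_iff, ← closure_range_adjSwap, Subgroup.closure_le]
  rintro _ ⟨k, rfl⟩
  exact ⟨_, permHom_s hsurj hker k⟩

/-- The identification of the Weyl group with the symmetric group, under which `w_k` becomes the
transposition of `lo k` and `hi k`. -/
noncomputable def weylEquiv : W π ≃* Equiv.Perm (Fin ℓ) :=
  (QuotientGroup.quotientMulEquivOfEq (ker_permHom hsurj hker).symm).trans
    (QuotientGroup.quotientKerEquivOfSurjective _ (permHom_surjective hsurj hker))

theorem weylEquiv_simpleReflection (k : Fin (ℓ - 1)) :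
    weylEquiv hsurj hker (simpleReflection π k) = adjSwap k :=
  permHom_s hsurj hker k

theorem weylEquiv_coxeterElement :
    weylEquiv hsurj hker (coxeterElement π) = (List.ofFn (adjSwap (ℓ := ℓ))).prod := by
  rw [coxeterElement, map_list_prod, List.map_ofFn]
  exact congrArg (fun f => (List.ofFn f).prod)
    (funext fun k => weylEquiv_simpleReflection hsurj hker k)

theorem weylEquiv_mem_closure_iff {θ : Set (Fin (ℓ - 1))} {w : W π} :
    weylEquiv hsurj hker w ∈ Subgroup.closure (adjSwap '' θ) ↔ w ∈ parabolic π θ := by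
  have h : (parabolic π θ).map (weylEquiv hsurj hker).toMonoidHom =
      Subgroup.closure (adjSwap '' θ) := by
    rw [parabolic, MonoidHom.map_closure, Set.image_image]
    exact congrArg _ (Set.image_congr fun k _ => weylEquiv_simpleReflection hsurj hker k)
  rw [← h]
  exact Subgroup.mem_map_iff_mem (weylEquiv hsurj hker).injective

theorem isConj_weylEquiv_iff {u w : W π} :
    IsConj (weylEquiv hsurj hker u) (weylEquiv hsurj hker w) ↔ IsConj u w := by
  refine ⟨fun h => ?_, fun h => (weylEquiv hsurj hker).toMonoidHom.map_isConj h⟩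
  simpa using (weylEquiv hsurj hker).symm.toMonoidHom.map_isConj h

theorem isElliptic_iff_isCycleOn_univ {w : W π} :
    IsElliptic π w ↔ (weylEquiv hsurj hker w).IsCycleOn Set.univ := by
  constructor
  · intro hw
    by_contra hcycle
    obtain ⟨k, u, hconj, hu⟩ := exists_isConj_mem_closure_adjSwap hcycle
    obtain ⟨u, rfl⟩ := (weylEquiv hsurj hker).surjective u
    refine hw {k}ᶜ (Set.compl_ne_univ.2 (Set.singleton_nonempty k)) u ?_ ?_
    · exact (isConj_weylEquiv_iff hsurj hker).1 hconj
    · exact (weylEquiv_mem_closure_iff hsurj hker).1 hu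
  · intro hcycle θ hθ u hconj hu
    have hucycle : (weylEquiv hsurj hker u).IsCycleOn Set.univ :=
      (isConj_iff_isCycleOn_univ hcycle).1 ((isConj_weylEquiv_iff hsurj hker).2 hconj)
    exact notMem_closure_adjSwap hucycle hθ ((weylEquiv_mem_closure_iff hsurj hker).2 hu)

theorem isElliptic_iff_isConj_coxeterElement (hsurj : Function.Surjective π)
    (hker : π.ker ≤ Subgroup.center SL(ℓ, ℂ)) {w : W π} :
    IsElliptic π w ↔ IsConj (coxeterElement π) w := by
  rw [isElliptic_iff_isCycleOn_univ hsurj hker, ← isConj_weylEquiv_iff hsurj hker,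
    weylEquiv_coxeterElement, isConj_iff_isCycleOn_univ isCycleOn_univ_prod_adjSwap]

variable {hsurj hker} {n : N π}

theorem isConj_param_iff (hℓ : 2 ≤ ℓ) (hn : (permHom hsurj hker n).IsCycleOn Set.univ)
    (t : tuples ℓ) :
    IsConj (n : G) (param π t) ↔ Function.Injective t.1 ∧ ∀ i j, t.1 i ^ ℓ = t.1 j ^ ℓ := by
  constructor
  · intro h
    obtain ⟨g, hg⟩ := isConj_iff.1 h.symm
    obtain ⟨P, rfl⟩ := hsurj g
    have hlift : π (P * diag ℓ t * P⁻¹) = n := by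
      rw [map_mul, map_mul, map_inv]
      exact hg
    exact (isConj_diag_iff hℓ (isMonomial_permHom hsurj hker hlift) hn t).1
      (isConj_iff.2 ⟨P, rfl⟩).symm
  · intro h
    obtain ⟨M, hM⟩ := hsurj n
    rw [← hM]
    exact π.map_isConj ((isConj_diag_iff hℓ (isMonomial_permHom hsurj hker hM) hn t).2 h)

theorem pow_eq_param_twoRho (hℓ : 2 ≤ ℓ) (hn : (permHom hsurj hker n).IsCycleOn Set.univ) :
    (n : G) ^ ℓ = param π (zpowTuple twoRho sum_twoRho (-1)) := by
  have : Nontrivial (Fin ℓ) := Fin.nontrivial_iff_two_le.2 hℓ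
  obtain ⟨M, hM⟩ := hsurj n
  have hpow : M.1 ^ ℓ = scalar (Fin ℓ) ((-1) ^ (ℓ + 1)) := by
    simpa only [Fintype.card_fin] using
      pow_card_of_det_eq_one (fun i j => (isMonomial_permHom hsurj hker hM i j).1) hn M.2
  have hexp (i : Fin ℓ) : (-1 : ℂ) ^ twoRho i = (-1) ^ (ℓ + 1) := by
    rw [show twoRho i = (ℓ + 1 : ℕ) + 2 * (-1 - (i : ℤ)) by simp only [twoRho]; push_cast; ring,
      zpow_add₀ (by norm_num), _root_.zpow_mul, zpow_natCast]
    norm_num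
  have hM_pow : M ^ ℓ = diag ℓ (zpowTuple twoRho sum_twoRho (-1)) := by
    refine Subtype.ext ((Matrix.SpecialLinearGroup.coe_pow M ℓ).trans (hpow.trans ?_))
    exact congrArg diagonal (funext fun i => by simpa [zpowTuple] using (hexp i).symm)
  rw [← hM, ← map_pow, hM_pow]
  rfl

theorem isOfFinOrder_of_isCycleOn_univ (hℓ : 2 ≤ ℓ)
    (hn : (permHom hsurj hker n).IsCycleOn Set.univ) : IsOfFinOrder (n : G) := by
  refine isOfFinOrder_iff_pow_eq_one.2 ⟨ℓ * 2, by omega, ?_⟩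
  rw [pow_mul, pow_eq_param_twoRho hℓ hn, ← map_pow, ← map_pow, neg_one_sq, map_one, map_one]

theorem dvd_orderOf_of_isCycleOn_univ (hℓ : 0 < ℓ)
    (hn : (permHom hsurj hker n).IsCycleOn Set.univ) : ℓ ∣ orderOf (n : G) := by
  have hfix : (permHom hsurj hker n ^ orderOf (n : G)) ⟨0, hℓ⟩ = ⟨0, hℓ⟩ := by
    rw [Subgroup.orderOf_coe, ← map_pow, pow_orderOf_eq_one, map_one, Equiv.Perm.one_apply]
  rw [← Finset.coe_univ] at hn
  simpa using (hn.pow_apply_eq (Finset.mem_univ _)).1 hfix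

end weyl

/-! ### Roots, coweights and the constants `b_γ` -/

section roots

variable {ℓ : ℕ}

theorem sub_last_eq_sum {M : Type*} [AddCommGroup M] {n : ℕ} (f : Fin (n + 1) → M)
    (i : Fin (n + 1)) :
    f i - f (Fin.last n) =
      ∑ k : Fin n, if i ≤ k.castSucc then f k.castSucc - f k.succ else 0 := by
  induction i using Fin.reverseInduction with
  | last => simp [Fin.not_le.2 (Fin.castSucc_lt_last _)]
  | cast i ih =>
    have hsplit (k : Fin n) : (if i.castSucc ≤ k.castSucc then f k.castSucc - f k.succ else 0) =
        (if k = i then f k.castSucc - f k.succ else 0) +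
          if i.succ ≤ k.castSucc then f k.castSucc - f k.succ else 0 := by
      simp only [Fin.le_def, Fin.ext_iff, Fin.val_castSucc, Fin.val_succ]
      split_ifs <;> first | omega | simp
    simp only [hsplit, Finset.sum_add_distrib, Finset.sum_ite_eq', Finset.mem_univ, if_true, ← ih]
    abel

theorem sub_eq_sum_smul {M : Type*} [AddCommGroup M] (f : Fin ℓ → M) (i j : Fin ℓ) :
    f i - f j = ∑ k, ((if i ≤ lo k then 1 else 0) - (if j ≤ lo k then 1 else 0) : ℤ) •
      (f (lo k) - f (hi k)) := by
  obtain _ | n := ℓ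
  · exact i.elim0
  · simp only [sub_smul, ite_smul, one_smul, zero_smul, Finset.sum_sub_distrib]
    rw [← sub_sub_sub_cancel_right (f i) (f j) (f (Fin.last n)), sub_last_eq_sum f i,
      sub_last_eq_sum f j]
    rfl

theorem sub_eq_sum_lo_sub_hi {M : Type*} [AddCommGroup M] (hℓ : 0 < ℓ) (f : Fin ℓ → M) :
    f ⟨0, hℓ⟩ - f ⟨ℓ - 1, by omega⟩ = ∑ k, (f (lo k) - f (hi k)) := by
  rw [sub_eq_sum_smul]
  refine Finset.sum_congr rfl fun k _ => ?_
  have hfirst : ⟨0, hℓ⟩ ≤ lo k := Nat.zero_le k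
  have hlast : ¬ ⟨ℓ - 1, by omega⟩ ≤ lo k := not_le.2 k.2
  rw [if_pos hfirst, if_neg hlast, sub_zero, one_smul]

theorem sum_rootVec_mul (i j : Fin ℓ) (v : Fin ℓ → ℝ) :
    ∑ a, (rootVec i j a : ℝ) * v a = v i - v j := by
  simp [rootVec, sub_mul, Finset.sum_sub_distrib, Pi.single_apply]

theorem sum_simpleRoot_mul (k : Fin (ℓ - 1)) (v : Fin ℓ → ℝ) :
    ∑ a, (simpleRoot k a : ℝ) * v a = v (lo k) - v (hi k) :=
  sum_rootVec_mul _ _ v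

theorem isHighestRoot_sum_simpleRoot (hℓ : 2 ≤ ℓ) :
    IsHighestRoot (∑ k : Fin (ℓ - 1), simpleRoot k) := by
  refine ⟨⟨_, _, ?_, (sub_eq_sum_lo_sub_hi (by omega) fun i => Pi.single i 1).symm⟩, ?_⟩
  · rw [ne_eq, Fin.mk.injEq]
    omega
  rintro _ ⟨i, j, -, rfl⟩
  refine ⟨fun k => (1 - ((if i ≤ lo k then 1 else 0) - (if j ≤ lo k then 1 else 0)) : ℤ).toNat, ?_⟩
  rw [rootVec, sub_eq_sum_smul (fun i => Pi.single i 1), ← Finset.sum_sub_distrib]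
  refine Finset.sum_congr rfl fun k _ => ?_
  rw [Int.toNat_of_nonneg (by split_ifs <;> norm_num), sub_smul (1 : ℤ), one_smul]
  rfl

theorem coweight_lo_sub_hi (k j : Fin (ℓ - 1)) :
    coweight k (lo j) - coweight k (hi j) = if k = j then 1 else 0 := by
  simp only [coweight, lo, hi, Fin.le_def, Fin.ext_iff]
  split_ifs <;> first | omega | simp

theorem sum_coweight (k : Fin (ℓ - 1)) : ∑ i, coweight k i = 0 := by
  have hℓ : (ℓ : ℝ) ≠ 0 := Nat.cast_ne_zero.2 (Nat.ne_zero_of_lt (lo k).2)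
  have hcard : ((Finset.univ.filter (· ≤ lo k)).card : ℝ) = k + 1 := by
    rw [show Finset.univ.filter (· ≤ lo k) = Finset.Iic (lo k) by ext; simp, Fin.card_Iic]
    exact Nat.cast_succ _
  simp only [coweight, Finset.sum_sub_distrib, Finset.sum_boole, hcard]
  rw [Finset.sum_const, Finset.card_univ, Fintype.card_fin, nsmul_eq_mul, mul_div_cancel₀ _ hℓ,
    sub_self]

theorem eq_sum_smul_coweight {v : Fin ℓ → ℝ} (hv : ∑ i, v i = 0) :
    v = ∑ k, (v (lo k) - v (hi k)) • coweight k := by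
  set u := ∑ k, (v (lo k) - v (hi k)) • coweight k with hu
  have hsub (i j : Fin ℓ) : v i - u i = v j - u j := by
    rw [sub_eq_sub_iff_sub_eq_sub, sub_eq_sum_smul v, hu]
    simp [coweight, ← Finset.sum_sub_distrib, ← mul_sub, mul_comm]
  have hsum : ∑ i, (v i - u i) = 0 := by
    simp only [hu, Finset.sum_apply, Pi.smul_apply, Finset.sum_sub_distrib, hv]
    rw [Finset.sum_comm]
    simp only [← Finset.smul_sum, sum_coweight, smul_zero, Finset.sum_const_zero, sub_zero]
  funext i
  have hℓ : ℓ ≠ 0 := by rintro rfl; exact i.elim0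
  rw [Fintype.sum_congr _ (fun _ => v i - u i) fun j => hsub j i] at hsum
  simpa [hℓ, sub_eq_zero] using hsum

theorem le_one_of_isRoot_sum {c : Fin (ℓ - 1) → ℕ}
    (h : IsRoot (∑ k, (c k : ℤ) • simpleRoot k)) (k : Fin (ℓ - 1)) : c k ≤ 1 := by
  obtain ⟨i, j, -, hij⟩ := h
  have hpair : ∑ a, ((∑ k, (c k : ℤ) • simpleRoot k) a : ℝ) * coweight k a = c k := by
    simp only [Finset.sum_apply, Pi.smul_apply, smul_eq_mul, Int.cast_sum, Int.cast_mul,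
      Int.cast_natCast, Finset.sum_mul, mul_assoc]
    rw [Finset.sum_comm]
    simp only [← Finset.mul_sum, sum_simpleRoot_mul, coweight_lo_sub_hi]
    simp
  rw [hij, sum_rootVec_mul] at hpair
  have hle : (c k : ℝ) ≤ 1 := by
    rw [← hpair]
    simp only [coweight]
    split_ifs <;> linarith
  exact_mod_cast hle

theorem isB_iff (hℓ : 2 ≤ ℓ) (b : Node ℓ → ℕ) : IsB b ↔ ∀ γ, b γ = 1 := by
  constructor
  · rintro ⟨h0, c, hc, hroot, hb⟩ (_ | k)
    · exact h0
    · have hck : c k = 1 := le_antisymm (le_one_of_isRoot_sum hroot.1 k) (hc k)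
      have h := hb k k
      rw [sum_simpleRoot_mul, coweight_lo_sub_hi, if_pos rfl, if_pos rfl, hck, Nat.cast_one,
        div_one] at h
      exact_mod_cast h.symm
  · intro h
    refine ⟨h _, fun _ => 1, fun _ => one_pos, ?_, fun k j => ?_⟩
    · simpa using isHighestRoot_sum_simpleRoot hℓ
    · rw [sum_simpleRoot_mul, coweight_lo_sub_hi, h]
      simp

theorem sum_smul_vertex {b : Node ℓ → ℕ} (hb : ∀ γ, b γ = 1) (τ : Node ℓ → ℕ) :
    ∑ γ, ((τ γ * b γ : ℕ) : ℝ) • vertex b γ = ∑ k, (τ (some k) : ℝ) • coweight k := by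
  rw [Fintype.sum_option]
  simp [vertex, hb]

theorem sum_smul_coweight_lo_sub_hi (a : Fin (ℓ - 1) → ℝ) (j : Fin (ℓ - 1)) :
    (∑ k, a k • coweight k) (lo j) - (∑ k, a k • coweight k) (hi j) = a j := by
  simp only [Finset.sum_apply, Pi.smul_apply, smul_eq_mul, ← Finset.sum_sub_distrib, ← mul_sub,
    coweight_lo_sub_hi]
  simp

theorem card_node (hℓ : 0 < ℓ) : Fintype.card (Node ℓ) = ℓ := by
  rw [Fintype.card_option, Fintype.card_fin, Nat.sub_add_cancel hℓ]

end roots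

/-! ### Cocharacters -/

section cocharacters

variable {ℓ : ℕ} {G : Type*} [Group G] {π : SL(ℓ, ℂ) →* G}

theorem exists_monoidHom_comp_eq {H K L : Type*} [Group H] [Group K] [Group L] {f : H →* K}
    (hf : Function.Surjective f) {g : H →* L} (h : f.ker ≤ g.ker) :
    ∃ φ : K →* L, ∀ x, φ (f x) = g x :=
  ⟨f.liftOfSurjective hf ⟨g, h⟩, f.liftOfRightInverse_comp_apply _ _ ⟨g, h⟩⟩

theorem powMonoidHom_units_surjective {K : Type*} [Field K] [IsAlgClosed K] {q : ℕ} (hq : 0 < q) :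
    Function.Surjective (powMonoidHom q : Kˣ →* Kˣ) := by
  intro z
  obtain ⟨y, hy⟩ := IsAlgClosed.exists_pow_nat_eq (z : K) hq
  have hy0 : y ≠ 0 := by
    rintro rfl
    exact z.ne_zero (by rw [← hy, zero_pow hq.ne'])
  exact ⟨Units.mk0 y hy0, Units.ext hy⟩

theorem prod_zpow_rootVec {H : Type*} [CommGroup H] (t : Fin ℓ → H) (i j : Fin ℓ) :
    ∏ a, t a ^ rootVec i j a = t i / t j := by
  simp only [rootVec, Pi.sub_apply, zpow_sub, Finset.prod_mul_distrib, Finset.prod_inv_distrib,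
    Pi.single_apply, div_eq_mul_inv]
  simp

theorem exists_isCharacter_rootVec (hker : π.ker ≤ Subgroup.center SL(ℓ, ℂ)) (i j : Fin ℓ) :
    ∃ χ : A π →* ℂˣ, IsCharacter π χ (rootVec i j) := by
  let coord (k : Fin ℓ) : tuples ℓ →* ℂˣ := (Pi.evalMonoidHom _ k).comp (tuples ℓ).subtype
  have hle : (param π).rangeRestrict.ker ≤ (coord i / coord j).ker := by
    intro t ht
    rw [MonoidHom.ker_rangeRestrict] at ht
    obtain ⟨r, -, hr⟩ := Matrix.SpecialLinearGroup.mem_center_iff.1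
      (hker (show diag ℓ t ∈ π.ker from ht))
    have hval (k : Fin ℓ) : r = t.1 k := congrFun (Matrix.diagonal_injective hr) k
    exact div_eq_one.2 (Units.ext ((hval i).symm.trans (hval j)))
  obtain ⟨χ, hχ⟩ := exists_monoidHom_comp_eq (param π).rangeRestrict_surjective hle
  exact ⟨χ, fun t => (hχ t).trans (prod_zpow_rootVec t.1 i j).symm⟩

theorem exists_param_eq_cocharacter (hker : π.ker ≤ Subgroup.center SL(ℓ, ℂ)) {c : ℂˣ →* A π}
    {v : Fin ℓ → ℝ} (hc : IsCocharacter π c) (hv : IsVectorOf π c v) (ξ : ℂˣ) :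
    ∃ t : tuples ℓ, param π t = c ξ ∧
      ∀ i j, ∃ k : ℤ, v i - v j = k ∧ t.1 i / t.1 j = ξ ^ k := by
  obtain ⟨t, ht⟩ := (param π).rangeRestrict_surjective (c ξ)
  refine ⟨t, congrArg Subtype.val ht, fun i j => ?_⟩
  obtain ⟨χ, hχ⟩ := exists_isCharacter_rootVec hker i j
  obtain ⟨k, hk⟩ := hc χ _ hχ
  refine ⟨k, ?_, ?_⟩
  · rw [← hv.2 χ _ k hχ hk, sum_rootVec_mul]
  · rw [← prod_zpow_rootVec, ← hχ, ht, hk]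

/-- The vectors of cocharacters of `A` form a lattice that may be larger than that of `SL_ℓ(ℂ)`:
it contains `f / q` if the cocharacter `f` of `SL_ℓ(ℂ)` maps the `q`-th roots of unity into the
kernel of `π`. -/
theorem exists_isCocharacter_isVectorOf {q : ℕ} (hq : 0 < q) {f : Fin ℓ → ℤ}
    (hf : ∑ i, f i = 0) (h : ∀ ζ : ℂˣ, ζ ^ q = 1 → param π (zpowTuple f hf ζ) = 1) :
    ∃ c : ℂˣ →* A π, IsCocharacter π c ∧ IsVectorOf π c fun i => (f i : ℝ) / q := by
  let g : ℂˣ →* A π := (param π).rangeRestrict.comp (zpowTuple f hf)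
  obtain ⟨c, hc⟩ : ∃ c : ℂˣ →* A π, ∀ y, c (y ^ q) = g y :=
    exists_monoidHom_comp_eq (powMonoidHom_units_surjective hq) fun ζ hζ => Subtype.ext (h ζ hζ)
  have hχ {χ e} (he : IsCharacter π χ e) (y : ℂˣ) : χ (c (y ^ q)) = y ^ ∑ i, f i * e i := by
    rw [hc, ← prod_zpow_eq_zpow_sum]
    exact (he _).trans (Finset.prod_congr rfl fun i _ => (zpow_mul y (f i) (e i)).symm)
  refine ⟨c, fun χ e he => ?_, ?_, fun χ e k he hk => ?_⟩
  · have hζ := (Complex.isPrimitiveRoot_exp q hq.ne').isUnit_unit hq.ne'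
    have hdvd : (q : ℤ) ∣ ∑ i, f i * e i := by
      rw [← hζ.zpow_eq_one_iff_dvd, ← hχ he, hζ.pow_eq_one, map_one, map_one]
    obtain ⟨k, hk⟩ := hdvd
    refine ⟨k, fun z => ?_⟩
    obtain ⟨y, rfl⟩ := powMonoidHom_units_surjective hq z
    rw [powMonoidHom_apply, hχ he, hk, zpow_mul, zpow_natCast]
  · rw [← Finset.sum_div, ← Int.cast_sum, hf, Int.cast_zero, zero_div]
  · obtain ⟨u, hu⟩ := exists_zpow_injective
    have hqk : q * k = ∑ i, f i * e i := hu <| by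
      simp only [← hχ he, hk, zpow_mul, zpow_natCast]
    have hq' : (q : ℝ) ≠ 0 := Nat.cast_ne_zero.2 hq.ne'
    calc ∑ i, (e i : ℝ) * (f i / q)
      _ = ((∑ i, f i * e i : ℤ) : ℝ) / q := by
        push_cast
        rw [Finset.sum_div]
        exact Finset.sum_congr rfl fun i _ => by ring
      _ = k := by rw [← hqk, Int.cast_mul, Int.cast_natCast, mul_div_cancel_left₀ _ hq']

variable {hsurj : Function.Surjective π} {hker : π.ker ≤ Subgroup.center SL(ℓ, ℂ)} {n : N π}

theorem isConj_cocharacter_iff (hℓ : 2 ≤ ℓ) (hn : (permHom hsurj hker n).IsCycleOn Set.univ)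
    {c : ℂˣ →* A π} {v : Fin ℓ → ℝ} (hc : IsCocharacter π c) (hv : IsVectorOf π c v)
    {d : ℕ} (hd : 0 < d) {ξ : ℂˣ} (hξ : IsPrimitiveRoot ξ (ℓ * d)) :
    IsConj (n : G) (c ξ) ↔ ∀ i j, i ≠ j → ∃ k : ℤ, v i - v j = d * k ∧ ¬ (ℓ : ℤ) ∣ k := by
  obtain ⟨t, ht, hratio⟩ := exists_param_eq_cocharacter hker hc hv ξ
  choose e hve hte using hratio
  have hpow (i j : Fin ℓ) : t.1 i ^ ℓ = t.1 j ^ ℓ ↔ (d : ℤ) ∣ e i j := by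
    rw [← div_eq_one, ← div_pow, hte, ← zpow_natCast, ← zpow_mul, hξ.zpow_eq_one_iff_dvd,
      Nat.cast_mul, mul_comm (e i j), mul_dvd_mul_iff_left (by omega)]
  have heq (i j : Fin ℓ) : t.1 i = t.1 j ↔ (ℓ * d : ℤ) ∣ e i j := by
    rw [← div_eq_one, hte, hξ.zpow_eq_one_iff_dvd, Nat.cast_mul]
  have hv_iff (i j : Fin ℓ) (k : ℤ) : v i - v j = d * k ↔ e i j = d * k := by
    rw [hve]
    norm_cast
  have hdvd_iff (k : ℤ) : (ℓ * d : ℤ) ∣ d * k ↔ (ℓ : ℤ) ∣ k := by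
    rw [mul_comm, mul_dvd_mul_iff_left (by omega)]
  rw [← ht, isConj_param_iff hℓ hn]
  simp only [hpow, hv_iff]
  constructor
  · rintro ⟨hinj, hdvd⟩ i j hij
    obtain ⟨k, hk⟩ := hdvd i j
    refine ⟨k, hk, fun h => hij (hinj ((heq i j).2 ?_))⟩
    rwa [hk, hdvd_iff]
  · intro h
    refine ⟨fun i j hij => ?_, fun i j => ?_⟩
    · by_contra hne
      obtain ⟨k, hk, hndvd⟩ := h i j hne
      rw [heq, hk, hdvd_iff] at hij
      exact hndvd hij
    · rcases eq_or_ne i j with rfl | hne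
      · exact (hpow i i).1 rfl
      · obtain ⟨k, hk, -⟩ := h i j hne
        exact ⟨k, hk⟩

end cocharacters

/-! ### Kac diagrams of lifts of elliptic elements -/

section kac

theorem eq_of_dvd_of_ne_zero_of_sum_eq {ι : Type*} [Fintype ι] {τ : ι → ℕ} {d : ℕ}
    (hdvd : ∀ i, d ∣ τ i) (hne : ∀ i, τ i ≠ 0) (hsum : ∑ i, τ i = Fintype.card ι * d) (i : ι) :
    τ i = d := by
  have hle (i : ι) : d ≤ τ i := Nat.le_of_dvd (Nat.pos_of_ne_zero (hne i)) (hdvd i)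
  have hsum' : ∑ _i : ι, d = ∑ i, τ i := by
    rw [hsum, Finset.sum_const, Finset.card_univ, smul_eq_mul]
  exact ((Finset.sum_eq_sum_iff_of_le fun i _ => hle i).1 hsum' i (Finset.mem_univ i)).symm

theorem eq_one_of_mul_eq_of_gcd_eq_one {ι : Type*} [Fintype ι] {σ : ι → ℕ} {D d : ℕ} (hD : 0 < D)
    (hσ : ∀ i, D * σ i = d) (hgcd : Finset.univ.gcd σ = 1) (i : ι) : σ i = 1 := by
  have hconst (j : ι) : σ i = σ j := Nat.eq_of_mul_eq_mul_left hD ((hσ i).trans (hσ j).symm)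
  exact Nat.dvd_one.1 (hgcd ▸ Finset.dvd_gcd fun j _ => (hconst j).dvd)

variable {ℓ : ℕ} {G : Type*} [Group G] {π : SL(ℓ, ℂ) →* G} {hsurj : Function.Surjective π}
  {hker : π.ker ≤ Subgroup.center SL(ℓ, ℂ)} {n : N π} {ξ : ℂˣ} {b σ : Node ℓ → ℕ}

theorem exists_orderOf_eq_mul (hℓ : 2 ≤ ℓ) (hn : (permHom hsurj hker n).IsCycleOn Set.univ) :
    ∃ d, 0 < d ∧ orderOf (n : G) = ℓ * d := by
  obtain ⟨d, hd⟩ := dvd_orderOf_of_isCycleOn_univ (by omega) hn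
  have hpos := (isOfFinOrder_of_isCycleOn_univ hℓ hn).orderOf_pos
  exact ⟨d, Nat.pos_of_mul_pos_left (hd ▸ hpos), hd⟩

/-- The label of the affine node is controlled by the highest root, at which `v` takes the value
`ℓ * d - τ none`. -/
theorem label_eq_of_sub_eq (hℓ : 2 ≤ ℓ) {d : ℕ} (hd : 0 < d) {τ : Node ℓ → ℕ} {v : Fin ℓ → ℝ}
    (hv : ∀ i j, i ≠ j → ∃ k : ℤ, v i - v j = d * k ∧ ¬ (ℓ : ℤ) ∣ k)
    (hτ : ∀ k, v (lo k) - v (hi k) = τ (some k)) (hsum : ∑ γ, τ γ = ℓ * d) (γ : Node ℓ) :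
    τ γ = d := by
  have hsum' := hsum
  rw [Fintype.sum_option] at hsum'
  have hhighest : v ⟨0, by omega⟩ - v ⟨ℓ - 1, by omega⟩ = ℓ * d - τ none := by
    rw [sub_eq_sum_lo_sub_hi (by omega), Finset.sum_congr rfl fun k _ => hτ k, eq_sub_iff_add_eq']
    exact_mod_cast hsum'
  have hlabel : ∀ γ, ∃ k : ℤ, (τ γ : ℤ) = d * k ∧ k ≠ 0 := by
    rintro (_ | k)
    · obtain ⟨k, hk, hndvd⟩ := hv ⟨0, by omega⟩ ⟨ℓ - 1, by omega⟩ (Fin.ne_of_lt (by simp; omega))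
      rw [hhighest] at hk
      have hk' : (ℓ * d - τ none : ℤ) = d * k := by exact_mod_cast hk
      exact ⟨ℓ - k, by linear_combination -hk', fun h => hndvd ⟨1, by linear_combination -h⟩⟩
    · obtain ⟨j, hj, hndvd⟩ := hv _ _ (lo_ne_hi k)
      rw [hτ] at hj
      refine ⟨j, by exact_mod_cast hj, ?_⟩
      rintro rfl
      exact hndvd (dvd_zero _)
  refine eq_of_dvd_of_ne_zero_of_sum_eq (fun γ => ?_) (fun γ => ?_) ?_ γ
  · obtain ⟨k, hk, -⟩ := hlabel γ
    exact Int.natCast_dvd_natCast.1 ⟨k, hk⟩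
  · obtain ⟨k, hk, hk0⟩ := hlabel γ
    have : (d * k : ℤ) ≠ 0 := mul_ne_zero (by omega) hk0
    omega
  · rw [hsum, card_node (by omega)]

theorem eq_one_of_isKacDiagram (hℓ : 2 ≤ ℓ) (hn : (permHom hsurj hker n).IsCycleOn Set.univ)
    (hξ : IsPrimitiveRoot ξ (orderOf (n : G))) (hb : ∀ γ, b γ = 1)
    (hσ : IsKacDiagram π b ξ n σ) (γ : Node ℓ) : σ γ = 1 := by
  obtain ⟨c, v, x, τ, hc, hv, hconj, hx, -, hsum, hx', ⟨D, hD, hDσ⟩, hgcd⟩ := hσ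
  obtain ⟨d, hd, hord⟩ := exists_orderOf_eq_mul hℓ hn
  have hv_eq : v = ∑ k, (τ (some k) : ℝ) • coweight k := by
    rw [← sum_smul_vertex hb]
    have hne : (orderOf (n : G) : ℝ)⁻¹ ≠ 0 :=
      inv_ne_zero (Nat.cast_ne_zero.2 (hord ▸ (Nat.mul_pos (by omega) hd).ne'))
    exact smul_right_injective _ hne (hx.symm.trans hx')
  simp only [hb, mul_one, hord] at hsum
  rw [hord] at hξ
  have hτ : ∀ γ, τ γ = d :=
    label_eq_of_sub_eq hℓ hd ((isConj_cocharacter_iff hℓ hn hc hv hd hξ).1 hconj)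
      (fun k => hv_eq ▸ sum_smul_coweight_lo_sub_hi _ k) hsum.symm
  exact eq_one_of_mul_eq_of_gcd_eq_one hD (fun γ => (hDσ γ).symm.trans (hτ γ)) hgcd γ

theorem exists_isVectorOf_mul_rho (hℓ : 2 ≤ ℓ)
    (hn : (permHom hsurj hker n).IsCycleOn Set.univ) {d : ℕ} (hord : orderOf (n : G) = ℓ * d) :
    ∃ c, IsCocharacter π c ∧ IsVectorOf π c fun i => d * (twoRho i / 2 : ℝ) := by
  have hsum : ∑ i : Fin ℓ, d * twoRho i = 0 := by rw [← Finset.mul_sum, sum_twoRho, mul_zero]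
  obtain ⟨c, hc, hv⟩ := exists_isCocharacter_isVectorOf (π := π) two_pos hsum fun ζ hζ => by
    have hpow (y : ℂˣ) : zpowTuple _ hsum y = zpowTuple twoRho sum_twoRho y ^ d :=
      Subtype.ext (funext fun i => (zpow_mul' y d (twoRho i)).trans (zpow_natCast _ d))
    rcases Units.sq_eq_sq_iff_eq_or_eq_neg.1 (hζ.trans (one_pow 2).symm) with rfl | rfl
    · rw [map_one, map_one]
    · rw [hpow, map_pow, ← pow_eq_param_twoRho hℓ hn, ← pow_mul, ← hord, pow_orderOf_eq_one]
  refine ⟨c, hc, ?_⟩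
  convert hv using 2 with i
  push_cast
  ring

theorem smul_mul_rho_mem_alcove (hℓ : 0 < ℓ) {d : ℕ} (hd : 0 < d) :
    (((ℓ * d : ℕ) : ℝ)⁻¹ • fun i => d * (twoRho i / 2 : ℝ)) ∈ alcove ℓ := by
  refine ⟨?_, fun i j hij => ?_⟩
  · have hsum : ∑ i : Fin ℓ, (twoRho i : ℝ) = 0 := by exact_mod_cast sum_twoRho
    simp only [Pi.smul_apply, smul_eq_mul]
    rw [← Finset.mul_sum, ← Finset.mul_sum, ← Finset.sum_div, hsum, zero_div, mul_zero, mul_zero]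
  · have hℓ' : (0 : ℝ) < ℓ := Nat.cast_pos.2 hℓ
    have hdiff : ((ℓ * d : ℕ) : ℝ)⁻¹ * (d * (twoRho i / 2)) -
        ((ℓ * d : ℕ) : ℝ)⁻¹ * (d * (twoRho j / 2)) = (j - i : ℝ) / ℓ := by
      simp only [twoRho]
      push_cast
      field_simp
      ring
    have hij' : (i : ℝ) < j := Nat.cast_lt.2 hij
    have hj : (j : ℝ) < ℓ := Nat.cast_lt.2 j.2
    simp only [Pi.smul_apply, smul_eq_mul]
    rw [hdiff, div_lt_one hℓ']
    exact ⟨div_pos (by linarith) hℓ', by linarith [Nat.cast_nonneg (α := ℝ) (i : ℕ)]⟩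

theorem isKacDiagram_self (hℓ : 2 ≤ ℓ) (hn : (permHom hsurj hker n).IsCycleOn Set.univ)
    (hξ : IsPrimitiveRoot ξ (orderOf (n : G))) (hb : ∀ γ, b γ = 1) :
    IsKacDiagram π b ξ n b := by
  obtain ⟨d, hd, hord⟩ := exists_orderOf_eq_mul hℓ hn
  obtain ⟨c, hc, hv⟩ := exists_isVectorOf_mul_rho hℓ hn hord
  have hdiff (i j : Fin ℓ) : d * (twoRho i / 2 : ℝ) - d * (twoRho j / 2) = d * (j - i : ℤ) := by
    simp only [twoRho]
    push_cast
    ring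
  rw [IsKacDiagram, hord]
  rw [hord] at hξ
  refine ⟨c, _, _, fun _ => d, hc, hv, ?_, rfl, ?_, ?_, ?_, ⟨d, hd, fun γ => ?_⟩, ?_⟩
  · refine (isConj_cocharacter_iff hℓ hn hc hv hd hξ).2 fun i j hij => ⟨j - i, hdiff i j, ?_⟩
    intro hdvd
    have hlt : |(j - i : ℤ)| < ℓ := abs_lt.2 (by omega)
    have := Int.eq_zero_of_abs_lt_dvd hdvd hlt
    omega
  · exact subset_closure (smul_mul_rho_mem_alcove (by omega) hd)
  · simp only [hb, mul_one]
    rw [Finset.sum_const, Finset.card_univ, card_node (by omega), smul_eq_mul]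
  · rw [sum_smul_vertex hb]
    congr 1
    refine (eq_sum_smul_coweight hv.1).trans (Finset.sum_congr rfl fun k _ => ?_)
    rw [hdiff, show ((hi k : ℕ) - (lo k : ℕ) : ℤ) = 1 by simp [lo, hi], Int.cast_one, mul_one]
  · rw [hb, mul_one]
  · exact Nat.dvd_one.1 ((Finset.gcd_dvd (Finset.mem_univ none)).trans (hb none).dvd)

end kac

end KacA

theorem mainTheorem4 (ℓ : ℕ) (hℓ : 2 ≤ ℓ) {G : Type*} [Group G]
    (π : Matrix.SpecialLinearGroup (Fin ℓ) ℂ →* G) (hsurj : Function.Surjective π)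
    (hker : π.ker ≤ Subgroup.center (Matrix.SpecialLinearGroup (Fin ℓ) ℂ)) :
    -- the elliptic elements form a single conjugacy class, that of the Coxeter element
    (∀ w : KacA.W π, KacA.IsElliptic π w ↔ IsConj (KacA.coxeterElement π) w) ∧
    -- the constants `b_γ` are all equal to one
    (∀ b : KacA.Node ℓ → ℕ, KacA.IsB b ↔ ∀ γ, b γ = 1) ∧
    -- every lift of an elliptic element has finite order, and it has exactly one Kac diagram,
    -- the diagram of the `b_γ`
    (∀ n : KacA.N π, KacA.IsElliptic π (QuotientGroup.mk n) →
      IsOfFinOrder (n : G) ∧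
      ∀ ξ : ℂˣ, IsPrimitiveRoot ξ (orderOf (n : G)) →
        ∀ b : KacA.Node ℓ → ℕ, KacA.IsB b →
          ∀ σ : KacA.Node ℓ → ℕ, KacA.IsKacDiagram π b ξ (n : G) σ ↔ σ = b) := by
  refine ⟨fun w => KacA.isElliptic_iff_isConj_coxeterElement hsurj hker, KacA.isB_iff hℓ,
    fun n hn => ?_⟩
  have hcycle : (KacA.permHom hsurj hker n).IsCycleOn Set.univ :=
    (KacA.isElliptic_iff_isCycleOn_univ hsurj hker).1 hn
  refine ⟨KacA.isOfFinOrder_of_isCycleOn_univ hℓ hcycle, fun ξ hξ b hb σ => ?_⟩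
  have hb_one : ∀ γ, b γ = 1 := (KacA.isB_iff hℓ b).1 hb
  constructor
  · intro hσ
    funext γ
    rw [KacA.eq_one_of_isKacDiagram hℓ hcycle hξ hb_one hσ, hb_one]
  · rintro rfl
    exact KacA.isKacDiagram_self hℓ hcycle hξ hb_one
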